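/- Let $n,N\ge 0$ be integers, let $\bar R\in\mathbb R$, and let $B_r\subset\mathbb R^N$ denote the open ball of radius $r$ centered at $0$. Let $\Sigma^n\subset B_{\bar R}$ be a proper rectifiable $n$-varifold, that is, a countably $n$-rectifiable set $M\subset B_{\bar R}$ with a positive multiplicity function $\theta$ such that the weight measure $\mu=\theta\,\mathcal H^n\llcorner M$ is finite on compact subsets of $B_{\bar R}$. Write $\mathrm{Vol}(A\cap\Sigma)=\mu(A)$ and $\int_{A\cap\Sigma}g=\int_A g\,d\mu$, and let $\mathrm{div}_\Sigma$ be the divergence along the approximate tangent planes of $M$. Assume that $\Sigma$ is $F$-stationary, i.e. the first variation of the Gaussian area $F(\Sigma)=(4\pi)^{-n/2}\int_\Sigma e^{-|x|^2/4}$ vanishes: $$\int_\Sigma\Big(\mathrm{div}_\Sigma X-\tfrac12\langle x,X\rangle\Big)e^{-|x|^2/4}=0$$ for every $C^1$ vector field $X$ with compact support in $B_{\bar R}$. Then: (1) If $\sqrt{4+2n}\le r_1<r_2<\bar R$, then $$\Big(1-\frac{2n}{r_2^2}\Big)\frac{\mathrm{Vol}(B_{r_2}\cap\Sigma)}{r_2^n}\le\frac{\mathrm{Vol}(B_{r_1}\cap\Sigma)}{r_1^n}.$$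 (2) $\Sigma$ has a generalized mean curvature vector $\mathbf H$ in $B_{\bar R}$, i.e. a locally $\mu$-integrable vector field with $\int_\Sigma\mathrm{div}_\Sigma Y=\int_\Sigma\langle\mathbf H,Y\rangle$ for every $C^1$ vector field $Y$ with compact support in $B_{\bar R}$; and for every such $\mathbf H$ and every $0<r<\bar R$ (in particular at regular values $r$ of $|x|$), $|\mathbf H|^2$ is integrable over $B_r\cap\Sigma$ and $$\int_{B_r\cap\Sigma}|\mathbf H|^2\le\frac n2\,\mathrm{Vol}(B_r\cap\Sigma).$$ -/

import Mathlib

open MeasureTheory Metric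

open scoped NNReal

noncomputable section

/-- The standard `n`-dimensional Hausdorff measure `ℋⁿ` on `ℝᴺ`. Mathlib's `μH[n]` is built from
`diam ^ n`; the usual normalising factor `ωₙ / 2ⁿ` is the Lebesgue measure of an `n`-dimensional
ball of diameter one. -/
def stdHausdorff (n N : ℕ) : Measure (EuclideanSpace ℝ (Fin N)) :=
  volume (ball (0 : EuclideanSpace ℝ (Fin n)) (1 / 2)) • Measure.hausdorffMeasure (n : ℝ)

/-- `f` parametrises, on the open set `O ⊆ ℝⁿ`, an injectively immersed `C¹` submanifold of `ℝᴺ`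
of dimension `n`. (Locally these are embedded, so countably many such patches cover the same sets
as countably many embedded `C¹` submanifolds.) -/
structure IsC1Patch {n N : ℕ} (O : Set (EuclideanSpace ℝ (Fin n)))
    (f : EuclideanSpace ℝ (Fin n) → EuclideanSpace ℝ (Fin N)) : Prop where
  isOpen : IsOpen O
  contDiffOn : ContDiffOn ℝ 1 f O
  injOn : Set.InjOn f O
  immersion : ∀ y ∈ O, Function.Injective (fderiv ℝ f y)

/-- `M` is countably `n`-rectifiable with (approximate) tangent planes `T`: up to an `ℋⁿ`-null
set, `M` is covered by countably many `n`-dimensional `C¹` submanifolds, and at `ℋⁿ`-almost every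
point `x` of `M` on such a submanifold, `T x` is the tangent space of the submanifold. This
determines `T` at `ℋⁿ`-almost every point of `M`. -/
def IsRectifiableWithTangent (n : ℕ) {N : ℕ} (M : Set (EuclideanSpace ℝ (Fin N)))
    (T : EuclideanSpace ℝ (Fin N) → Submodule ℝ (EuclideanSpace ℝ (Fin N))) : Prop :=
  ∃ (O : ℕ → Set (EuclideanSpace ℝ (Fin n)))
    (f : ℕ → EuclideanSpace ℝ (Fin n) → EuclideanSpace ℝ (Fin N)),
    (∀ j, IsC1Patch (O j) (f j)) ∧
    stdHausdorff n N (M \ ⋃ j, f j '' O j) = 0 ∧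
    ∀ j, stdHausdorff n N
      {x | x ∈ M ∧ ∃ y ∈ O j, f j y = x ∧ T x ≠ (fderiv ℝ (f j) y).range} = 0

/-- A rectifiable `n`-varifold in the open set `U ⊆ ℝᴺ`: a countably `n`-rectifiable set
`M ⊆ U` with a positive multiplicity function that is locally `ℋⁿ`-integrable in `U`, together
with the tangent planes of `M`. (As usual such data are considered up to `ℋⁿ`-null sets, so that
Borel representatives lose nothing.) Finiteness on the compact subsets of `U` is what makes the
varifold proper in `U`. -/
structure RectifiableVarifold (n N : ℕ) (U : Set (EuclideanSpace ℝ (Fin N))) where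
  carrier : Set (EuclideanSpace ℝ (Fin N))
  carrier_subset : carrier ⊆ U
  measurableSet_carrier : MeasurableSet carrier
  multiplicity : EuclideanSpace ℝ (Fin N) → ℝ≥0
  measurable_multiplicity : Measurable multiplicity
  multiplicity_pos : ∀ x ∈ carrier, 0 < multiplicity x
  tangent : EuclideanSpace ℝ (Fin N) → Submodule ℝ (EuclideanSpace ℝ (Fin N))
  rectifiable : IsRectifiableWithTangent n carrier tangent
  lintegral_lt_top : ∀ K ⊆ U, IsCompact K →
    ∫⁻ x in K ∩ carrier, (multiplicity x : ENNReal) ∂(stdHausdorff n N) < ⊤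

namespace RectifiableVarifold

variable {n N : ℕ} {U : Set (EuclideanSpace ℝ (Fin N))}

/-- The weight (volume) measure of the varifold: `ℋⁿ` restricted to the carrier, times the
multiplicity. Thus `Vol (A ∩ Σ) = Σ.weight A` and `∫_{A ∩ Σ} g = ∫ x in A, g x ∂Σ.weight`. -/
def weight (V : RectifiableVarifold n N U) : Measure (EuclideanSpace ℝ (Fin N)) :=
  ((stdHausdorff n N).restrict V.carrier).withDensity fun x => (V.multiplicity x : ENNReal)

/-- The tangential divergence `div_Σ X (x) = ∑ᵢ ⟨eᵢ, DX(x) eᵢ⟩`, `eᵢ` an orthonormal basis of the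
tangent plane at `x`, written as the trace of `P ∘ DX(x)` where `P` is the orthogonal projection
onto the tangent plane. -/
def tangentialDiv (V : RectifiableVarifold n N U)
    (X : EuclideanSpace ℝ (Fin N) → EuclideanSpace ℝ (Fin N)) (x : EuclideanSpace ℝ (Fin N)) : ℝ :=
  LinearMap.trace ℝ (EuclideanSpace ℝ (Fin N))
    ((V.tangent x).starProjection ∘L fderiv ℝ X x).toLinearMap

/-- `V` is `F`-stationary in `U`: the first variation of the Gaussian area
`F(Σ) = (4π)^(-n/2) ∫_Σ exp(-|x|²/4)` vanishes along every `C¹` vector field with compact support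
in `U`. -/
def IsFStationary (V : RectifiableVarifold n N U) : Prop :=
  ∀ X : EuclideanSpace ℝ (Fin N) → EuclideanSpace ℝ (Fin N),
    ContDiff ℝ 1 X → HasCompactSupport X → tsupport X ⊆ U →
    (4 * Real.pi) ^ (-(n : ℝ) / 2) *
      ∫ x, (V.tangentialDiv X x - inner ℝ x (X x) / 2) * Real.exp (-‖x‖ ^ 2 / 4) ∂V.weight = 0

/-- `H` is the (generalised) mean curvature vector of `V` in `U`: it is locally integrable and
`∫_Σ div_Σ Y = ∫_Σ ⟨H, Y⟩` for every `C¹` vector field `Y` with compact support in `U`. The sign is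
the one for which shrinkers satisfy `H = x^⊥ / 2`, so that `H = n x / |x|²` on a round sphere. -/
structure IsMeanCurvature (V : RectifiableVarifold n N U)
    (H : EuclideanSpace ℝ (Fin N) → EuclideanSpace ℝ (Fin N)) : Prop where
  locallyIntegrableOn : LocallyIntegrableOn H U V.weight
  integral_eq : ∀ Y : EuclideanSpace ℝ (Fin N) → EuclideanSpace ℝ (Fin N),
    ContDiff ℝ 1 Y → HasCompactSupport Y → tsupport Y ⊆ U →
    ∫ x, V.tangentialDiv Y x ∂V.weight = ∫ x, inner ℝ (H x) (Y x) ∂V.weight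

end RectifiableVarifold

end

/-! Write `P` for the tangential projection and `q = |x - P x|²`. Testing stationarity with `exp
(|x|² / 4) • Y` cancels the Gaussian weight: the gradient of the exponential removes the tangential
half of `x / 2`, and what remains says that `(x - P x) / 2` is a mean curvature vector. Mean
curvature vectors agree almost everywhere in the ball, so `|H|² = q / 4` for every one of them.

With `Y = ψ (|x|²) x` the formula becomes `∫ (n ψ + 2 ψ' (|x|² - q) - ψ q / 2) = 0`
(`IsFStationary.radial_identity`), and both claims are choices of `ψ`. If `ψ` decreases from one to
zero near `r²`, the `ψ'` term is nonpositive, and in the limit `∫ q ≤ 2 n Vol` on the ball of radius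
`r`; this is the curvature bound.

For monotonicity take `ψ' = -s ^ (-n/2 - 1) / 2` on `[r₁², r₂²)`, `ψ` constant below and zero above
(`IsFStationary.truncated_power_identity`). The terms without `q` collapse to `r₁⁻ⁿ - r₂⁻ⁿ` on the
inner ball and `-r₂⁻ⁿ` on the annulus. In the annulus the coefficient of `q` is `s ^ (-n/2 - 1) - ψ
/ 2`, which is at most `r₂ ^ (-n - 2)` once `r₁² ≥ 4 + 2 n` (`rpow_sub_le_integral_powProfile`).
Bounding `∫ q` by `2 n Vol` produces the factor `1 - 2 n / r₂²`. -/

/-! ### Orthogonal projections onto ranges, and traces -/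

section Projection

variable {E F : Type*} [NormedAddCommGroup E] [InnerProductSpace ℝ E] [FiniteDimensional ℝ E]
  [NormedAddCommGroup F] [InnerProductSpace ℝ F] [FiniteDimensional ℝ F]

theorem ContinuousLinearMap.isUnit_adjoint_comp_self {A : F →L[ℝ] E}
    (hA : Function.Injective A) : IsUnit ((ContinuousLinearMap.adjoint A) ∘L A : F →L[ℝ] F) := by
  have hinj : Function.Injective ((ContinuousLinearMap.adjoint A) ∘L A : F →L[ℝ] F) := by
    refine (injective_iff_map_eq_zero _).2 fun v hv => ?_
    have h : inner ℝ (A v) (A v) = 0 := by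
      rw [← ContinuousLinearMap.adjoint_inner_left]
      simp only [ContinuousLinearMap.comp_apply] at hv
      rw [hv, inner_zero_left]
    exact (injective_iff_map_eq_zero A).1 hA v (inner_self_eq_zero.1 h)
  rw [ContinuousLinearMap.isUnit_iff_bijective]
  exact ⟨hinj, (LinearMap.injective_iff_surjective
    (f := ((ContinuousLinearMap.adjoint A) ∘L A : F →L[ℝ] F).toLinearMap)).1 hinj⟩

/-- The orthogonal projection onto the range of an injective operator `A` is `A (A* A)⁻¹ A*`. -/
theorem starProjection_range_eq {A : F →L[ℝ] E} (hA : Function.Injective A) :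
    A.range.starProjection =
      A ∘L (Ring.inverse ((ContinuousLinearMap.adjoint A) ∘L A : F →L[ℝ] F)) ∘L
        (ContinuousLinearMap.adjoint A) := by
  ext u
  refine Submodule.eq_starProjection_of_mem_of_inner_eq_zero ⟨_, rfl⟩ ?_
  rintro w ⟨z, rfl⟩
  have h := Ring.mul_inverse_cancel _ (ContinuousLinearMap.isUnit_adjoint_comp_self hA)
  have h' := congrArg (fun B : F →L[ℝ] F => B ((ContinuousLinearMap.adjoint A) u)) h
  simp only [mul_apply_eq_comp, ContinuousLinearMap.comp_apply,
    one_apply_eq_self] at h'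
  change inner ℝ _ (A z) = 0
  rw [← ContinuousLinearMap.adjoint_inner_left, map_sub]
  simp only [ContinuousLinearMap.comp_apply]
  rw [h', sub_self, inner_zero_left]

/-- Inversion is continuous at units and `A* A` is a unit when `A` is injective. This makes the
tangent projection depend continuously on the parameter of a `C¹` patch. -/
theorem continuousAt_starProjection_range_formula {A : F →L[ℝ] E} (hA : Function.Injective A) :
    ContinuousAt (fun B : F →L[ℝ] E =>
      B ∘L (Ring.inverse ((ContinuousLinearMap.adjoint B) ∘L B : F →L[ℝ] F)) ∘L
        (ContinuousLinearMap.adjoint B)) A := by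
  have hadj : Continuous fun B : F →L[ℝ] E => ContinuousLinearMap.adjoint B :=
    (ContinuousLinearMap.adjoint (𝕜 := ℝ) (E := F) (F := E)).continuous
  have hinv : ContinuousAt (fun B : F →L[ℝ] E =>
      Ring.inverse ((ContinuousLinearMap.adjoint B) ∘L B : F →L[ℝ] F)) A := by
    obtain ⟨u, hu⟩ := ContinuousLinearMap.isUnit_adjoint_comp_self hA
    refine ContinuousAt.comp (g := Ring.inverse)
      (f := fun B : F →L[ℝ] E => ((ContinuousLinearMap.adjoint B) ∘L B : F →L[ℝ] F)) ?_
      (hadj.clm_comp continuous_id).continuousAt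
    rw [← hu]
    exact NormedRing.inverse_continuousAt u
  exact continuousAt_id.clm_comp (hinv.clm_comp hadj.continuousAt)

theorem trace_starProjection (K : Submodule ℝ E) :
    LinearMap.trace ℝ E K.starProjection.toLinearMap = Module.finrank ℝ K := by
  refine LinearMap.IsProj.trace ⟨fun x => ?_, fun x hx => ?_⟩
  · exact Submodule.starProjection_apply_mem K x
  · exact Submodule.starProjection_eq_self_iff.2 hx

theorem LinearMap.continuous_trace_clm :
    Continuous fun A : E →L[ℝ] E => LinearMap.trace ℝ E A.toLinearMap :=
  LinearMap.continuous_of_finiteDimensional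
    (f := (LinearMap.trace ℝ E).comp (ContinuousLinearMap.coeLM ℝ (M := E) (N₃ := E)))

theorem exists_abs_trace_le :
    ∃ C : ℝ, 0 ≤ C ∧ ∀ A : E →L[ℝ] E, |LinearMap.trace ℝ E A.toLinearMap| ≤ C * ‖A‖ := by
  let t : (E →L[ℝ] E) →L[ℝ] ℝ := LinearMap.toContinuousLinearMap
    ((LinearMap.trace ℝ E).comp (ContinuousLinearMap.coeLM ℝ (M := E) (N₃ := E)))
  exact ⟨‖t‖, norm_nonneg t, fun A => t.le_opNorm A⟩

end Projection

/-! ### Measurability along `C¹` patches -/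

section Patch

variable {n N : ℕ}

theorem IsC1Patch.measurableSet_image {O : Set (EuclideanSpace ℝ (Fin n))}
    {f : EuclideanSpace ℝ (Fin n) → EuclideanSpace ℝ (Fin N)} (h : IsC1Patch O f) :
    MeasurableSet (f '' O) :=
  h.isOpen.measurableSet.image_of_continuousOn_injOn h.contDiffOn.continuousOn h.injOn

/-- Along a `C¹` patch the projections onto the tangent spaces extend to a Borel function on the
ambient space. -/
theorem IsC1Patch.exists_measurable_projection {O : Set (EuclideanSpace ℝ (Fin n))}
    {f : EuclideanSpace ℝ (Fin n) → EuclideanSpace ℝ (Fin N)} (h : IsC1Patch O f) :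
    ∃ Φ : EuclideanSpace ℝ (Fin N) → (EuclideanSpace ℝ (Fin N) →L[ℝ] EuclideanSpace ℝ (Fin N)),
      StronglyMeasurable Φ ∧ ∀ y ∈ O, Φ (f y) = (fderiv ℝ f y).range.starProjection := by
  have hemb := h.contDiffOn.continuousOn.measurableEmbedding h.isOpen.measurableSet h.injOn
  let g : O → (EuclideanSpace ℝ (Fin N) →L[ℝ] EuclideanSpace ℝ (Fin N)) :=
    fun y => (fderiv ℝ f y).range.starProjection
  have hg : Continuous g := by
    rw [continuous_iff_continuousAt]
    intro y
    have hd : Continuous fun y : O => fderiv ℝ f y :=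
      continuousOn_iff_continuous_domRestrict.1
        (h.contDiffOn.continuousOn_fderiv_of_isOpen h.isOpen le_rfl)
    have h1 := ContinuousAt.comp (f := fun y : O => fderiv ℝ f y) (x := y)
      (continuousAt_starProjection_range_formula (h.immersion y y.2)) hd.continuousAt
    refine h1.congr (Filter.Eventually.of_forall fun z => ?_)
    exact (starProjection_range_eq (h.immersion z z.2)).symm
  refine ⟨Function.extend (O.domRestrict f) g 0, ?_, fun y hy => ?_⟩
  · exact (hemb.measurable_extend hg.measurable measurable_const).stronglyMeasurable
  · exact hemb.injective.extend_apply g 0 ⟨y, hy⟩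

end Patch

/-! ### Tangential divergence, and mean curvature of `F`-stationary varifolds -/

namespace RectifiableVarifold

variable {n N : ℕ} {U : Set (EuclideanSpace ℝ (Fin N))}

/-- The orthogonal projection onto the tangent plane. -/
noncomputable def tangentProj (V : RectifiableVarifold n N U) (x : EuclideanSpace ℝ (Fin N)) :
    EuclideanSpace ℝ (Fin N) →L[ℝ] EuclideanSpace ℝ (Fin N) :=
  (V.tangent x).starProjection

theorem weight_absolutelyContinuous (V : RectifiableVarifold n N U) :
    V.weight ≪ (stdHausdorff n N).restrict V.carrier :=
  withDensity_absolutelyContinuous _ _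

/-- No measurability of `tangent` is part of the data; it follows from rectifiability. Almost all of
the carrier lies in countably many patches, and on each one the projection agrees almost everywhere
with a Borel function. -/
theorem aestronglyMeasurable_tangentProj (V : RectifiableVarifold n N U) :
    AEStronglyMeasurable V.tangentProj V.weight := by
  refine AEStronglyMeasurable.mono_ac V.weight_absolutelyContinuous ?_
  obtain ⟨O, f, hp, hcov, htan⟩ := V.rectifiable
  have hM : V.carrier =ᵐ[stdHausdorff n N] ⋃ j, V.carrier ∩ f j '' O j := by
    rw [← Set.inter_iUnion]
    refine Filter.EventuallyEq.symm (Filter.EventuallyLE.antisymm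
      (Filter.Eventually.of_forall fun x hx => hx.1) ?_)
    rw [ae_le_set]
    rwa [Set.sdiff_self_inter]
  rw [Measure.restrict_congr_set hM, aestronglyMeasurable_iUnion_iff]
  intro j
  obtain ⟨Φ, hΦ, hΦ'⟩ := (hp j).exists_measurable_projection
  refine ⟨Φ, hΦ, ?_⟩
  rw [Filter.EventuallyEq, ae_restrict_iff'
    (V.measurableSet_carrier.inter (hp j).measurableSet_image)]
  filter_upwards [measure_eq_zero_iff_ae_notMem.1 (htan j)] with x hx hxM
  obtain ⟨hxM, y, hy, rfl⟩ := hxM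
  rw [hΦ' y hy, tangentProj]
  congr 1
  by_contra hne
  exact hx ⟨hxM, y, hy, rfl, hne⟩

theorem ae_finrank_tangent (V : RectifiableVarifold n N U) :
    ∀ᵐ x ∂V.weight, Module.finrank ℝ (V.tangent x) = n := by
  refine V.weight_absolutelyContinuous.ae_le ?_
  change ∀ᵐ x ∂(stdHausdorff n N).restrict V.carrier, Module.finrank ℝ (V.tangent x) = n
  rw [ae_restrict_iff' V.measurableSet_carrier]
  obtain ⟨O, f, hp, hcov, htan⟩ := V.rectifiable
  filter_upwards [measure_eq_zero_iff_ae_notMem.1 hcov,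
    ae_all_iff.2 fun j => measure_eq_zero_iff_ae_notMem.1 (htan j)] with x hx1 hx2 hxM
  have hx : x ∈ ⋃ j, f j '' O j := by
    by_contra h
    exact hx1 ⟨hxM, h⟩
  obtain ⟨j, y, hy, rfl⟩ := Set.mem_iUnion.1 hx
  have hT : V.tangent (f j y) = (fderiv ℝ (f j) y).range := by
    by_contra hne
    exact hx2 j ⟨hxM, y, hy, rfl, hne⟩
  rw [hT, LinearMap.finrank_range_of_inj ((hp j).immersion y hy), finrank_euclideanSpace_fin]

theorem ae_trace_tangentProj (V : RectifiableVarifold n N U) :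
    ∀ᵐ x ∂V.weight, LinearMap.trace ℝ _ (V.tangentProj x).toLinearMap = n := by
  filter_upwards [V.ae_finrank_tangent] with x hx
  rw [tangentProj, trace_starProjection, hx]

theorem weight_lt_top_of_isCompact (V : RectifiableVarifold n N U)
    {K : Set (EuclideanSpace ℝ (Fin N))} (hKU : K ⊆ U) (hK : IsCompact K) : V.weight K < ⊤ := by
  rw [weight, withDensity_apply _ hK.measurableSet, Measure.restrict_restrict hK.measurableSet]
  exact V.lintegral_lt_top K hKU hK

theorem norm_tangentProj_le (V : RectifiableVarifold n N U) (x : EuclideanSpace ℝ (Fin N)) :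
    ‖V.tangentProj x‖ ≤ 1 :=
  Submodule.starProjection_norm_le _

/-- The derivative of `u • Y` differs from `u • DY` by the rank-one map `v ↦ du(v) Y`; after
projecting, its trace is `du (P Y)`. -/
theorem tangentialDiv_smul (V : RectifiableVarifold n N U) {u : EuclideanSpace ℝ (Fin N) → ℝ}
    {Y : EuclideanSpace ℝ (Fin N) → EuclideanSpace ℝ (Fin N)} {x : EuclideanSpace ℝ (Fin N)}
    (hu : DifferentiableAt ℝ u x) (hY : DifferentiableAt ℝ Y x) :
    V.tangentialDiv (fun z => u z • Y z) x =
      u x * V.tangentialDiv Y x + fderiv ℝ u x (V.tangentProj x (Y x)) := by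
  have h : ((V.tangent x).starProjection ∘L fderiv ℝ (fun z => u z • Y z) x).toLinearMap =
      u x • ((V.tangent x).starProjection ∘L fderiv ℝ Y x).toLinearMap +
        (fderiv ℝ u x).toLinearMap.smulRight (V.tangentProj x (Y x)) := by
    rw [fderiv_fun_smul hu hY]
    ext1 v
    simp [tangentProj]
  rw [tangentialDiv, h, map_add, map_smul, LinearMap.trace_smulRight]
  rfl

theorem tangentialDiv_id (V : RectifiableVarifold n N U) (x : EuclideanSpace ℝ (Fin N)) :
    V.tangentialDiv (fun z => z) x = LinearMap.trace ℝ _ (V.tangentProj x).toLinearMap := by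
  rw [tangentialDiv, fderiv_fun_id]
  rfl

theorem integrable_of_tsupport (V : RectifiableVarifold n N U) {F : Type*}
    [NormedAddCommGroup F] {g : EuclideanSpace ℝ (Fin N) → F}
    (hg : AEStronglyMeasurable g V.weight) {K : Set (EuclideanSpace ℝ (Fin N))} (hK : IsCompact K)
    (hKU : K ⊆ U) (hgK : ∀ x, x ∉ K → g x = 0) {C : ℝ} (hC : ∀ x, ‖g x‖ ≤ C) :
    Integrable g V.weight := by
  rw [← integrableOn_iff_integrable_of_support_subset (s := K)
    fun x hx => by_contra fun h => hx (hgK x h)]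
  exact Measure.integrableOn_of_bounded (V.weight_lt_top_of_isCompact hKU hK).ne hg
    (Filter.Eventually.of_forall hC)

theorem integrable_tangentialDiv (V : RectifiableVarifold n N U)
    {Y : EuclideanSpace ℝ (Fin N) → EuclideanSpace ℝ (Fin N)} (hY : ContDiff ℝ 1 Y)
    (hc : HasCompactSupport Y) (hU : tsupport Y ⊆ U) :
    Integrable (V.tangentialDiv Y) V.weight := by
  have hd : Continuous (fderiv ℝ Y) := hY.continuous_fderiv one_ne_zero
  obtain ⟨C, hC⟩ := (hc.fderiv (𝕜 := ℝ)).exists_bound_of_continuous hd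
  obtain ⟨D, hD0, hD⟩ := exists_abs_trace_le (E := EuclideanSpace ℝ (Fin N))
  refine V.integrable_of_tsupport (K := tsupport Y) (C := D * (1 * C)) ?_ hc hU ?_ ?_
  · exact LinearMap.continuous_trace_clm.comp_aestronglyMeasurable
      ((continuous_fst.clm_comp continuous_snd).comp_aestronglyMeasurable
        (V.aestronglyMeasurable_tangentProj.prodMk hd.aestronglyMeasurable))
  · intro x hx
    have : fderiv ℝ Y x = 0 := by
      by_contra h
      exact hx (support_fderiv_subset ℝ h)
    simp [tangentialDiv, this]
  · intro x
    refine (hD _).trans (mul_le_mul_of_nonneg_left ?_ hD0)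
    refine (ContinuousLinearMap.opNorm_comp_le _ _).trans ?_
    exact mul_le_mul (V.norm_tangentProj_le x) (hC x) (norm_nonneg _) zero_le_one

/-- Half of the normal part of the position vector. -/
noncomputable def shrinkerCurvature (V : RectifiableVarifold n N U) (x : EuclideanSpace ℝ (Fin N)) :
    EuclideanSpace ℝ (Fin N) :=
  (1 / 2 : ℝ) • (x - V.tangentProj x x)

theorem aestronglyMeasurable_shrinkerCurvature (V : RectifiableVarifold n N U) :
    AEStronglyMeasurable V.shrinkerCurvature V.weight := by
  have hc : Continuous fun p : (EuclideanSpace ℝ (Fin N) →L[ℝ] EuclideanSpace ℝ (Fin N)) ×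
      EuclideanSpace ℝ (Fin N) => (1 / 2 : ℝ) • (p.2 - p.1 p.2) := by fun_prop
  have hid : AEStronglyMeasurable (fun x : EuclideanSpace ℝ (Fin N) => x) V.weight :=
    continuous_id.aestronglyMeasurable
  exact hc.comp_aestronglyMeasurable (V.aestronglyMeasurable_tangentProj.prodMk hid)

theorem norm_sub_tangentProj_le (V : RectifiableVarifold n N U) (x : EuclideanSpace ℝ (Fin N)) :
    ‖x - V.tangentProj x x‖ ≤ ‖x‖ := by
  rw [tangentProj, ← Submodule.starProjection_orthogonal_val]
  exact Submodule.norm_starProjection_apply_le _ _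

theorem norm_shrinkerCurvature_le (V : RectifiableVarifold n N U) (x : EuclideanSpace ℝ (Fin N)) :
    ‖V.shrinkerCurvature x‖ ≤ ‖x‖ := by
  rw [shrinkerCurvature, norm_smul, Real.norm_of_nonneg (by norm_num)]
  linarith [V.norm_sub_tangentProj_le x, norm_nonneg x]

theorem locallyIntegrableOn_shrinkerCurvature (V : RectifiableVarifold n N U) (hU : IsOpen U) :
    LocallyIntegrableOn V.shrinkerCurvature U V.weight := by
  rw [locallyIntegrableOn_iff hU.isLocallyClosed]
  intro K hKU hK
  obtain ⟨C, hC⟩ := hK.isBounded.exists_norm_le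
  refine Measure.integrableOn_of_bounded (M := C) (V.weight_lt_top_of_isCompact hKU hK).ne
    V.aestronglyMeasurable_shrinkerCurvature ?_
  filter_upwards [ae_restrict_mem hK.measurableSet] with x hx
  exact (V.norm_shrinkerCurvature_le x).trans (hC x hx)

theorem hasFDerivAt_exp_sq_div_four (x : EuclideanSpace ℝ (Fin N)) :
    HasFDerivAt (fun z : EuclideanSpace ℝ (Fin N) => Real.exp (‖z‖ ^ 2 / 4))
      (Real.exp (‖x‖ ^ 2 / 4) • ((1 / 2 : ℝ) • innerSL ℝ x)) x := by
  have h := ((hasStrictFDerivAt_norm_sq x).hasFDerivAt.const_mul (1 / 4 : ℝ)).exp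
  have h2 : (1 / 4 : ℝ) • (2 : ℕ) • innerSL ℝ x = (1 / 2 : ℝ) • innerSL ℝ x := by
    ext v
    simp
    ring
  rw [h2] at h
  have e : ∀ z : EuclideanSpace ℝ (Fin N), 1 / 4 * ‖z‖ ^ 2 = ‖z‖ ^ 2 / 4 := fun z => by ring
  simpa only [e] using h

/-- The gradient of the exponential is `x / 2` times itself, so it contributes `⟨P x, Y⟩ / 2`.
Against `⟨x, Y⟩ / 2` this leaves the normal part only. -/
theorem stationarity_integrand_exp_smul (V : RectifiableVarifold n N U)
    {Y : EuclideanSpace ℝ (Fin N) → EuclideanSpace ℝ (Fin N)} {x : EuclideanSpace ℝ (Fin N)}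
    (hY : DifferentiableAt ℝ Y x) :
    (V.tangentialDiv (fun z => Real.exp (‖z‖ ^ 2 / 4) • Y z) x
        - inner ℝ x (Real.exp (‖x‖ ^ 2 / 4) • Y x) / 2) * Real.exp (-‖x‖ ^ 2 / 4) =
      V.tangentialDiv Y x - inner ℝ (V.shrinkerCurvature x) (Y x) := by
  have hd := hasFDerivAt_exp_sq_div_four x
  rw [V.tangentialDiv_smul hd.differentiableAt hY, hd.fderiv]
  have hsymm : inner ℝ x (V.tangentProj x (Y x)) = inner ℝ (V.tangentProj x x) (Y x) :=
    (Submodule.inner_starProjection_left_eq_right _ _ _).symm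
  have he : Real.exp (‖x‖ ^ 2 / 4) * Real.exp (-‖x‖ ^ 2 / 4) = 1 := by
    rw [← Real.exp_add, neg_div, add_neg_cancel, Real.exp_zero]
  rw [shrinkerCurvature, real_inner_smul_left, real_inner_smul_right, inner_sub_left]
  simp only [smul_apply, innerSL_apply_apply, smul_eq_mul, hsymm]
  linear_combination (V.tangentialDiv Y x + 1 / 2 * inner ℝ (V.tangentProj x x) (Y x)
    - 1 / 2 * inner ℝ x (Y x)) * he

theorem integrable_inner_shrinkerCurvature (V : RectifiableVarifold n N U)
    {Y : EuclideanSpace ℝ (Fin N) → EuclideanSpace ℝ (Fin N)} (hY : Continuous Y)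
    (hc : HasCompactSupport Y) (hYU : tsupport Y ⊆ U) :
    Integrable (fun x => inner ℝ (V.shrinkerCurvature x) (Y x)) V.weight := by
  obtain ⟨C, hC⟩ := hc.exists_bound_of_continuous hY
  obtain ⟨D, hD⟩ := hc.isCompact.isBounded.exists_norm_le
  refine V.integrable_of_tsupport (K := tsupport Y) (C := |D| * C) ?_ hc hYU ?_ ?_
  · exact V.aestronglyMeasurable_shrinkerCurvature.inner hY.aestronglyMeasurable
  · intro x hx
    rw [image_eq_zero_of_notMem_tsupport hx, inner_zero_right]
  · intro x
    by_cases hx : x ∈ tsupport Y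
    · refine (norm_inner_le_norm _ _).trans (mul_le_mul ?_ (hC x) (norm_nonneg _) (abs_nonneg _))
      exact ((V.norm_shrinkerCurvature_le x).trans (hD x hx)).trans (le_abs_self D)
    · rw [image_eq_zero_of_notMem_tsupport hx, inner_zero_right, norm_zero]
      exact mul_nonneg (abs_nonneg _) ((norm_nonneg _).trans (hC x))

theorem IsFStationary.isMeanCurvature {V : RectifiableVarifold n N U} (hV : V.IsFStationary)
    (hU : IsOpen U) : V.IsMeanCurvature V.shrinkerCurvature := by
  refine ⟨V.locallyIntegrableOn_shrinkerCurvature hU, fun Y hY hc hYU => ?_⟩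
  have hexp : ContDiff ℝ 1 fun z : EuclideanSpace ℝ (Fin N) => Real.exp (‖z‖ ^ 2 / 4) :=
    ((contDiff_norm_sq ℝ).div_const 4).exp
  have hsupp : tsupport (fun z => Real.exp (‖z‖ ^ 2 / 4) • Y z) ⊆ tsupport Y :=
    tsupport_smul_subset_right _ Y
  have h := hV (fun z => Real.exp (‖z‖ ^ 2 / 4) • Y z) (hexp.smul hY)
    (hc.of_isClosed_subset (isClosed_tsupport _) hsupp) (hsupp.trans hYU)
  have hpos : (4 * Real.pi) ^ (-(n : ℝ) / 2) ≠ 0 := by positivity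
  have h := (mul_eq_zero.1 h).resolve_left hpos
  simp only [fun x => V.stationarity_integrand_exp_smul (hY.differentiable one_ne_zero x)] at h
  rw [integral_sub (V.integrable_tangentialDiv hY hc hYU)
    (V.integrable_inner_shrinkerCurvature hY.continuous hc hYU)] at h
  exact sub_eq_zero.1 h

/-- Fields `g • v` with `g` a bump function and `v` a constant vector already determine a locally
integrable `H`, by the fundamental lemma of the calculus of variations. -/
theorem IsMeanCurvature.ae_eq {V : RectifiableVarifold n N U} (hU : IsOpen U)
    {H H' : EuclideanSpace ℝ (Fin N) → EuclideanSpace ℝ (Fin N)} (h : V.IsMeanCurvature H)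
    (h' : V.IsMeanCurvature H') : ∀ᵐ x ∂V.weight, x ∈ U → H x = H' x := by
  have key := hU.ae_eq_zero_of_integral_contDiff_smul_eq_zero (μ := V.weight)
    (h.locallyIntegrableOn.sub h'.locallyIntegrableOn) ?_
  · filter_upwards [key] with x hx hxU
    exact sub_eq_zero.1 (hx hxU)
  intro g hg hgc hgU
  have hint : ∀ {G : EuclideanSpace ℝ (Fin N) → EuclideanSpace ℝ (Fin N)},
      LocallyIntegrableOn G U V.weight → Integrable (fun x => g x • G x) V.weight := by
    intro G hG
    rw [← integrableOn_iff_integrable_of_support_subset (s := tsupport g)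
      fun x hx => subset_tsupport g fun h0 => hx (by simp [h0])]
    exact (hG.integrableOn_compact_subset hgU hgc).continuousOn_smul hg.continuous.continuousOn hgc
  have e : ∀ x, g x • (H - H') x = g x • H x - g x • H' x := fun x => smul_sub _ _ _
  simp only [e]
  rw [integral_sub (hint h.locallyIntegrableOn) (hint h'.locallyIntegrableOn), sub_eq_zero]
  refine ext_inner_left ℝ fun v => ?_
  rw [← integral_inner (hint h.locallyIntegrableOn), ← integral_inner (hint h'.locallyIntegrableOn)]
  have hsupp : tsupport (fun z => g z • v) ⊆ tsupport g := tsupport_smul_subset_left g _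
  have hg1 : ContDiff ℝ 1 fun z => g z • v := (hg.of_le (by exact_mod_cast le_top)).smul contDiff_const
  have a := h.integral_eq (fun z => g z • v) hg1 hgc.smul_right (hsupp.trans hgU)
  have b := h'.integral_eq (fun z => g z • v) hg1 hgc.smul_right (hsupp.trans hgU)
  have e2 : ∀ (G : EuclideanSpace ℝ (Fin N) → EuclideanSpace ℝ (Fin N)) x,
      inner ℝ v (g x • G x) = inner ℝ (G x) (g x • v) := fun G x => by
    rw [real_inner_smul_right, real_inner_smul_right, real_inner_comm]
  simp only [e2]
  rw [← a, ← b]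

end RectifiableVarifold

/-! ### Radial test fields and the bound on the normal part -/

/-- The endpoint `s = b` is included because the sphere bounding an open ball may carry mass; there
the right derivative decides. -/
theorem deriv_eq_zero_of_forall_ge {ψ ψ' : ℝ → ℝ} {b s : ℝ} (hψ : HasDerivAt ψ (ψ' s) s)
    (h0 : ∀ t, b ≤ t → ψ t = 0) (hs : b ≤ s) : ψ' s = 0 := by
  have h1 : HasDerivWithinAt ψ 0 (Set.Ici s) s :=
    (hasDerivWithinAt_const s (Set.Ici s) (0 : ℝ)).congr
      (fun t ht => h0 t (hs.trans ht)) (h0 s hs)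
  exact (uniqueDiffWithinAt_Ici s).eq_deriv _ hψ.hasDerivWithinAt h1

namespace RectifiableVarifold

variable {n N : ℕ} {R : ℝ}

/-- The squared length of the normal part of the position vector. -/
noncomputable def normalSq {U : Set (EuclideanSpace ℝ (Fin N))} (V : RectifiableVarifold n N U)
    (x : EuclideanSpace ℝ (Fin N)) : ℝ :=
  ‖x - V.tangentProj x x‖ ^ 2

section

variable {U : Set (EuclideanSpace ℝ (Fin N))} (V : RectifiableVarifold n N U)

theorem normalSq_nonneg (x : EuclideanSpace ℝ (Fin N)) : 0 ≤ V.normalSq x := sq_nonneg _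

theorem normalSq_le (x : EuclideanSpace ℝ (Fin N)) : V.normalSq x ≤ ‖x‖ ^ 2 :=
  pow_le_pow_left₀ (norm_nonneg _) (V.norm_sub_tangentProj_le x) 2

theorem inner_sub_tangentProj_self (x : EuclideanSpace ℝ (Fin N)) :
    inner ℝ (x - V.tangentProj x x) x = V.normalSq x := by
  have h : inner ℝ (x - V.tangentProj x x) (V.tangentProj x x) = 0 :=
    Submodule.starProjection_inner_eq_zero x _ (Submodule.starProjection_apply_mem _ x)
  rw [normalSq, ← real_inner_self_eq_norm_sq, inner_sub_right _ x, h, sub_zero]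

theorem inner_tangentProj_self (x : EuclideanSpace ℝ (Fin N)) :
    inner ℝ x (V.tangentProj x x) = ‖x‖ ^ 2 - V.normalSq x := by
  rw [← V.inner_sub_tangentProj_self, inner_sub_left, real_inner_self_eq_norm_sq,
    real_inner_comm x]
  ring

theorem norm_sq_shrinkerCurvature (x : EuclideanSpace ℝ (Fin N)) :
    ‖V.shrinkerCurvature x‖ ^ 2 = V.normalSq x / 4 := by
  rw [shrinkerCurvature, norm_smul, mul_pow, normalSq, Real.norm_of_nonneg (by norm_num)]
  ring

theorem aestronglyMeasurable_normalSq : AEStronglyMeasurable V.normalSq V.weight := by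
  have h : V.normalSq = fun x => 4 * ‖V.shrinkerCurvature x‖ ^ 2 := by
    ext x
    rw [V.norm_sq_shrinkerCurvature]
    ring
  rw [h]
  exact (V.aestronglyMeasurable_shrinkerCurvature.norm.pow 2).const_mul 4

theorem tangentialDiv_radial {ψ : ℝ → ℝ} {c : ℝ} {x : EuclideanSpace ℝ (Fin N)}
    (hψ : HasDerivAt ψ c (‖x‖ ^ 2)) :
    V.tangentialDiv (fun z => ψ (‖z‖ ^ 2) • z) x =
      ψ (‖x‖ ^ 2) * LinearMap.trace ℝ _ (V.tangentProj x).toLinearMap +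
        2 * c * (‖x‖ ^ 2 - V.normalSq x) := by
  have hd : HasFDerivAt (fun z : EuclideanSpace ℝ (Fin N) => ψ (‖z‖ ^ 2))
      (c • (2 : ℕ) • innerSL ℝ x) x :=
    hψ.comp_hasFDerivAt x (hasStrictFDerivAt_norm_sq x).hasFDerivAt
  rw [V.tangentialDiv_smul hd.differentiableAt differentiableAt_fun_id, V.tangentialDiv_id, hd.fderiv,
    ← V.inner_tangentProj_self]
  simp
  ring

end

variable {V : RectifiableVarifold n N (ball (0 : EuclideanSpace ℝ (Fin N)) R)}

theorem isFiniteMeasure_restrict_ball (V : RectifiableVarifold n N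
    (ball (0 : EuclideanSpace ℝ (Fin N)) R)) {r : ℝ} (hr : r < R) :
    IsFiniteMeasure (V.weight.restrict (ball 0 r)) := by
  refine ⟨?_⟩
  rw [Measure.restrict_apply_univ]
  exact (measure_mono ball_subset_closedBall).trans_lt
    (V.weight_lt_top_of_isCompact (closedBall_subset_ball hr) (isCompact_closedBall 0 r))

/-- The first variation formula for the radial field `ψ (|x|²) x`. -/
theorem IsFStationary.radial_identity (hV : V.IsFStationary) {r : ℝ} (hr0 : 0 ≤ r) (hr : r < R)
    {ψ ψ' : ℝ → ℝ} (hψ : ∀ s, HasDerivAt ψ (ψ' s) s) (hψ' : Continuous ψ')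
    (h0 : ∀ s, r ^ 2 ≤ s → ψ s = 0) :
    IntegrableOn (fun x => n * ψ (‖x‖ ^ 2) + 2 * ψ' (‖x‖ ^ 2) * (‖x‖ ^ 2 - V.normalSq x)
        - ψ (‖x‖ ^ 2) * V.normalSq x / 2) (ball 0 r) V.weight ∧
      ∫ x in ball 0 r, (n * ψ (‖x‖ ^ 2) + 2 * ψ' (‖x‖ ^ 2) * (‖x‖ ^ 2 - V.normalSq x)
        - ψ (‖x‖ ^ 2) * V.normalSq x / 2) ∂V.weight = 0 := by
  have hψ1 : ContDiff ℝ 1 ψ := by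
    rw [contDiff_one_iff_deriv]
    exact ⟨fun s => (hψ s).differentiableAt, by rwa [funext fun s => (hψ s).deriv]⟩
  set Y : EuclideanSpace ℝ (Fin N) → EuclideanSpace ℝ (Fin N) := fun z => ψ (‖z‖ ^ 2) • z with hYdef
  have hY : ContDiff ℝ 1 Y := (hψ1.comp (contDiff_norm_sq ℝ)).smul contDiff_id
  have hout : ∀ x : EuclideanSpace ℝ (Fin N), x ∉ ball (0 : EuclideanSpace ℝ (Fin N)) r →
      r ^ 2 ≤ ‖x‖ ^ 2 := by
    intro x hx
    rw [mem_ball_zero_iff, not_lt] at hx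
    exact pow_le_pow_left₀ hr0 hx 2
  have hsub : tsupport Y ⊆ closedBall 0 r := by
    refine closure_minimal (fun x hx => ?_) isClosed_closedBall
    by_contra hxr
    refine hx ?_
    rw [hYdef]
    simp only
    rw [h0 _ (hout x fun h => hxr (ball_subset_closedBall h)), zero_smul]
  have hc : HasCompactSupport Y :=
    (isCompact_closedBall _ _).of_isClosed_subset (isClosed_tsupport _) hsub
  have hYU : tsupport Y ⊆ ball 0 R := hsub.trans (closedBall_subset_ball hr)
  have hi1 := V.integrable_tangentialDiv hY hc hYU
  have hi2 := V.integrable_inner_shrinkerCurvature hY.continuous hc hYU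
  have hmc := (hV.isMeanCurvature isOpen_ball).integral_eq Y hY hc hYU
  set F : EuclideanSpace ℝ (Fin N) → ℝ := fun x =>
    n * ψ (‖x‖ ^ 2) + 2 * ψ' (‖x‖ ^ 2) * (‖x‖ ^ 2 - V.normalSq x)
        - ψ (‖x‖ ^ 2) * V.normalSq x / 2 with hF
  have hae : (fun x => V.tangentialDiv Y x - inner ℝ (V.shrinkerCurvature x) (Y x))
      =ᵐ[V.weight] F := by
    filter_upwards [V.ae_trace_tangentProj] with x hx
    rw [hYdef, V.tangentialDiv_radial (hψ _), hx, shrinkerCurvature, real_inner_smul_left,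
      real_inner_smul_right, V.inner_sub_tangentProj_self, hF]
    ring
  have hFi : Integrable F V.weight := (hi1.sub hi2).congr hae
  refine ⟨hFi.integrableOn, ?_⟩
  rw [setIntegral_eq_integral_of_forall_compl_eq_zero, ← integral_congr_ae hae,
    integral_sub hi1 hi2, hmc, sub_self]
  intro x hx
  rw [h0 _ (hout x hx), deriv_eq_zero_of_forall_ge (hψ _) h0 (hout x hx)]
  ring

theorem normalSq_le_of_mem_ball {U : Set (EuclideanSpace ℝ (Fin N))}
    (V : RectifiableVarifold n N U) {r : ℝ} {x : EuclideanSpace ℝ (Fin N)} (hx : x ∈ ball 0 r) :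
    V.normalSq x ≤ r ^ 2 :=
  (V.normalSq_le x).trans (pow_le_pow_left₀ (norm_nonneg _) (mem_ball_zero_iff.1 hx).le 2)

theorem integrableOn_normalSq (V : RectifiableVarifold n N
    (ball (0 : EuclideanSpace ℝ (Fin N)) R)) {r : ℝ} (hr : r < R) :
    IntegrableOn V.normalSq (ball 0 r) V.weight := by
  have := V.isFiniteMeasure_restrict_ball hr
  refine Integrable.of_bound V.aestronglyMeasurable_normalSq.restrict (r ^ 2) ?_
  filter_upwards [ae_restrict_mem measurableSet_ball] with x hx
  rw [Real.norm_of_nonneg (V.normalSq_nonneg x)]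
  exact V.normalSq_le_of_mem_ball hx

theorem IsFStationary.integral_normalSq_le (hV : V.IsFStationary) {r : ℝ} (hr0 : 0 < r)
    (hr : r < R) :
    ∫ x in ball 0 r, V.normalSq x ∂V.weight ≤ 2 * n * V.weight.real (ball 0 r) := by
  have hfin := V.isFiniteMeasure_restrict_ball hr
  -- A decreasing cutoff: zero for `s ≥ r²`, and one as soon as `k (r² - s) ≥ 1`.
  let ψ : ℕ → ℝ → ℝ := fun k s => Real.smoothTransition (k * (r ^ 2 - s))
  have hψc : ∀ k, ContDiff ℝ 1 (ψ k) := fun k =>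
    Real.smoothTransition.contDiff.comp (contDiff_const.mul (contDiff_const.sub contDiff_id))
  have hanti : ∀ k, Antitone (ψ k) := fun k s t hst =>
    Real.smoothTransition.monotone
      (mul_le_mul_of_nonneg_left (by linarith) (Nat.cast_nonneg k))
  have hmeas : ∀ k, AEStronglyMeasurable (fun x => (n : ℝ) - ψ k (‖x‖ ^ 2) * V.normalSq x / 2)
      (V.weight.restrict (ball 0 r)) := by
    intro k
    have h1 : Continuous fun x : EuclideanSpace ℝ (Fin N) => ψ k (‖x‖ ^ 2) / 2 :=
      ((hψc k).continuous.comp (continuous_norm.pow 2)).div_const 2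
    have h2 : AEStronglyMeasurable (fun x => ψ k (‖x‖ ^ 2) / 2 * V.normalSq x)
        (V.weight.restrict (ball 0 r)) :=
      h1.aestronglyMeasurable.mul V.aestronglyMeasurable_normalSq.restrict
    simp only [mul_div_right_comm]
    exact aestronglyMeasurable_const.sub h2
  have hbd : ∀ k, ∀ᵐ x ∂V.weight.restrict (ball 0 r),
      ‖(n : ℝ) - ψ k (‖x‖ ^ 2) * V.normalSq x / 2‖ ≤ n + r ^ 2 := by
    intro k
    filter_upwards [ae_restrict_mem measurableSet_ball] with x hx
    have a1 := V.normalSq_le_of_mem_ball hx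
    have a2 := V.normalSq_nonneg x
    have a3 : 0 ≤ ψ k (‖x‖ ^ 2) := Real.smoothTransition.nonneg _
    have a4 : ψ k (‖x‖ ^ 2) ≤ 1 := Real.smoothTransition.le_one _
    have a5 : ψ k (‖x‖ ^ 2) * V.normalSq x ≤ 1 * V.normalSq x :=
      mul_le_mul_of_nonneg_right a4 a2
    have a6 := mul_nonneg a3 a2
    have a7 : (0 : ℝ) ≤ n := Nat.cast_nonneg n
    rw [Real.norm_eq_abs, abs_le]
    constructor <;> linarith
  have hk : ∀ k, 0 ≤ ∫ x in ball 0 r, ((n : ℝ) - ψ k (‖x‖ ^ 2) * V.normalSq x / 2) ∂V.weight := by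
    intro k
    obtain ⟨hi, he⟩ := hV.radial_identity hr0.le hr (ψ := ψ k) (ψ' := deriv (ψ k))
      (fun s => ((hψc k).differentiable one_ne_zero s).hasDerivAt)
      ((hψc k).continuous_deriv le_rfl)
      (fun s hs => Real.smoothTransition.zero_of_nonpos
        (mul_nonpos_of_nonneg_of_nonpos (Nat.cast_nonneg k) (by linarith)))
    -- The `ψ'` term is nonpositive, because `ψ k` decreases and `q ≤ |x|²`; dropping it and using
    -- `ψ k ≤ 1` in the first term only enlarges the integrand.
    rw [← he]
    refine integral_mono hi (Integrable.of_bound (hmeas k) _ (hbd k)) fun x => ?_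
    have b1 : deriv (ψ k) (‖x‖ ^ 2) ≤ 0 := (hanti k).deriv_nonpos
    have b2 : 0 ≤ ‖x‖ ^ 2 - V.normalSq x := sub_nonneg.2 (V.normalSq_le x)
    have b3 : (n : ℝ) * ψ k (‖x‖ ^ 2) ≤ n * 1 :=
      mul_le_mul_of_nonneg_left (Real.smoothTransition.le_one _) (Nat.cast_nonneg n)
    have b4 := mul_nonneg_of_nonpos_of_nonpos b1 (neg_nonpos.2 b2)
    simp only
    linarith
  have hlim := tendsto_integral_of_dominated_convergence
    (f := fun x => (n : ℝ) - V.normalSq x / 2) (fun _ => (n : ℝ) + r ^ 2) hmeas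
    (integrable_const _) hbd (by
      filter_upwards [ae_restrict_mem measurableSet_ball] with x hx
      have hx' : 0 < r ^ 2 - ‖x‖ ^ 2 :=
        sub_pos.2 (pow_lt_pow_left₀ (mem_ball_zero_iff.1 hx) (norm_nonneg _) two_ne_zero)
      obtain ⟨K, hK⟩ := exists_nat_ge (1 / (r ^ 2 - ‖x‖ ^ 2))
      refine tendsto_const_nhds.congr' ?_
      filter_upwards [Filter.eventually_ge_atTop K] with k hkK
      have : ψ k (‖x‖ ^ 2) = 1 := by
        refine Real.smoothTransition.one_of_one_le ?_
        rw [div_le_iff₀ hx'] at hK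
        exact hK.trans (mul_le_mul_of_nonneg_right (by exact_mod_cast hkK) hx'.le)
      rw [this, one_mul])
  have h := ge_of_tendsto' hlim hk
  rw [integral_sub (integrable_const _) ((V.integrableOn_normalSq hr).div_const 2),
    integral_div, setIntegral_const, smul_eq_mul] at h
  linarith

theorem IsFStationary.integral_sq_norm_curvature (hV : V.IsFStationary)
    {H : EuclideanSpace ℝ (Fin N) → EuclideanSpace ℝ (Fin N)} (hH : V.IsMeanCurvature H) {r : ℝ}
    (hr0 : 0 < r) (hr : r < R) :
    IntegrableOn (fun x => ‖H x‖ ^ 2) (ball 0 r) V.weight ∧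
      ∫ x in ball 0 r, ‖H x‖ ^ 2 ∂V.weight ≤ (n : ℝ) / 2 * V.weight.real (ball 0 r) := by
  have hae : (fun x => V.normalSq x / 4) =ᵐ[V.weight.restrict (ball 0 r)] fun x => ‖H x‖ ^ 2 := by
    filter_upwards [ae_restrict_mem measurableSet_ball,
      ae_restrict_of_ae (hH.ae_eq isOpen_ball (hV.isMeanCurvature isOpen_ball))] with x hx hx'
    rw [hx' (ball_subset_ball hr.le hx), V.norm_sq_shrinkerCurvature]
  refine ⟨((V.integrableOn_normalSq hr).div_const 4).congr hae, ?_⟩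
  rw [← integral_congr_ae hae, integral_div]
  linarith [hV.integral_normalSq_le hr0 hr]

end RectifiableVarifold

/-! ### The truncated power profile and its smooth approximation -/

section Profile

/-- The power `t ^ (-p - 1) / 2`, frozen below `a`. -/
noncomputable def powProfile (p a t : ℝ) : ℝ := max t a ^ (-p - 1) / 2

variable {p a b : ℝ}

theorem continuous_powProfile (ha : 0 < a) : Continuous (powProfile p a) :=
  ((continuous_id.max continuous_const).rpow_const
    fun t => Or.inl (ha.trans_le (le_max_right t a)).ne').div_const 2

theorem powProfile_nonneg (ha : 0 < a) (t : ℝ) : 0 ≤ powProfile p a t :=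
  div_nonneg (Real.rpow_nonneg (ha.le.trans (le_max_right t a)) _) zero_le_two

theorem powProfile_le (hp : 0 ≤ p) (ha : 0 < a) (t : ℝ) :
    powProfile p a t ≤ a ^ (-p - 1) / 2 :=
  div_le_div_of_nonneg_right
    (Real.rpow_le_rpow_of_nonpos ha (le_max_right t a) (by linarith)) zero_le_two

theorem powProfile_of_le {t : ℝ} (h : a ≤ t) : powProfile p a t = t ^ (-p - 1) / 2 := by
  rw [powProfile, max_eq_left h]

/-- Keeping the factor `2 * p` on the left, instead of dividing by it, covers `p = 0`, that is,
dimension zero. -/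
theorem integral_powProfile (ha : 0 < a) {m : ℝ} (hm : a ≤ m) (hmb : m ≤ b) :
    2 * p * ∫ t in m..b, powProfile p a t = m ^ (-p) - b ^ (-p) := by
  have h := intervalIntegral.integral_eq_sub_of_hasDerivAt (a := m) (b := b)
    (f := fun t : ℝ => -t ^ (-p)) (f' := fun t => 2 * p * powProfile p a t) (fun t ht => by
      rw [Set.uIcc_of_le hmb] at ht
      have h1 := (Real.hasDerivAt_rpow_const (x := t) (p := -p)
        (Or.inl (ha.trans_le (hm.trans ht.1)).ne')).fun_neg
      refine h1.congr_deriv ?_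
      rw [powProfile_of_le (hm.trans ht.1)]
      ring) ((continuous_const.mul (continuous_powProfile ha)).intervalIntegrable _ _)
  rw [intervalIntegral.integral_const_mul] at h
  rw [h]
  ring

/-- The left side is the integral of `(p + 1) t ^ (-p - 2)`, and this integrand is at most `t ^ (-p
- 1) / 4` exactly when `4 (p + 1) ≤ t`. -/
theorem rpow_sub_le_integral_powProfile (ha : 0 < a) (hpa : 4 * (p + 1) ≤ a) {m : ℝ}
    (hm : a ≤ m) (hmb : m ≤ b) :
    m ^ (-p - 1) - b ^ (-p - 1) ≤ (∫ t in m..b, powProfile p a t) / 2 := by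
  have hcont : ContinuousOn (fun t : ℝ => (p + 1) * t ^ (-p - 1 - 1)) (Set.uIcc m b) := by
    rw [Set.uIcc_of_le hmb]
    exact continuousOn_const.mul (continuousOn_id.rpow_const
      fun t ht => Or.inl (ha.trans_le (hm.trans ht.1)).ne')
  have h := intervalIntegral.integral_eq_sub_of_hasDerivAt (a := m) (b := b)
    (f := fun t : ℝ => -t ^ (-p - 1)) (f' := fun t => (p + 1) * t ^ (-p - 1 - 1)) (fun t ht => by
      rw [Set.uIcc_of_le hmb] at ht
      have h1 := (Real.hasDerivAt_rpow_const (x := t) (p := -p - 1)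
        (Or.inl (ha.trans_le (hm.trans ht.1)).ne')).fun_neg
      refine h1.congr_deriv ?_
      ring) hcont.intervalIntegrable
  have hle : ∫ t in m..b, (p + 1) * t ^ (-p - 1 - 1) ≤ ∫ t in m..b, powProfile p a t / 2 := by
    refine intervalIntegral.integral_mono_on hmb hcont.intervalIntegrable
      (((continuous_powProfile (p := p) ha).div_const 2).intervalIntegrable m b) fun t ht => ?_
    have ht0 : 0 < t := ha.trans_le (hm.trans ht.1)
    rw [powProfile_of_le (hm.trans ht.1)]
    have e : t ^ (-p - 1) = t ^ (-p - 1 - 1) * t := by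
      rw [← Real.rpow_add_one ht0.ne']
      ring_nf
    rw [e]
    have := mul_le_mul_of_nonneg_left (hpa.trans (hm.trans ht.1))
      (Real.rpow_nonneg ht0.le (-p - 1 - 1))
    linarith
  rw [h, intervalIntegral.integral_div] at hle
  linarith

/-- A continuous approximation of the indicator of `[a, b)`, vanishing on `[b, ∞)`. -/
noncomputable def smoothIco (a b : ℝ) (k : ℕ) (t : ℝ) : ℝ :=
  Real.smoothTransition (k * (t - a) + 1) - Real.smoothTransition (k * (t - b) + 1)

theorem continuous_smoothIco (k : ℕ) : Continuous (smoothIco a b k) := by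
  unfold smoothIco
  have := Real.smoothTransition.continuous
  fun_prop

theorem smoothIco_nonneg (hab : a ≤ b) (k : ℕ) (t : ℝ) : 0 ≤ smoothIco a b k t := by
  refine sub_nonneg.2 (Real.smoothTransition.monotone ?_)
  have : (k : ℝ) * (t - b) ≤ k * (t - a) :=
    mul_le_mul_of_nonneg_left (by linarith) (Nat.cast_nonneg k)
  linarith

theorem smoothIco_le_one (k : ℕ) (t : ℝ) : smoothIco a b k t ≤ 1 := by
  have h1 := Real.smoothTransition.le_one (k * (t - a) + 1)
  have h2 := Real.smoothTransition.nonneg (k * (t - b) + 1)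
  unfold smoothIco
  linarith

theorem smoothIco_eq_zero (hab : a ≤ b) (k : ℕ) {t : ℝ} (ht : b ≤ t) : smoothIco a b k t = 0 := by
  rw [smoothIco, Real.smoothTransition.one_of_one_le, Real.smoothTransition.one_of_one_le, sub_self]
  · linarith [mul_nonneg (Nat.cast_nonneg (α := ℝ) k) (sub_nonneg.2 ht)]
  · linarith [mul_nonneg (Nat.cast_nonneg (α := ℝ) k) (sub_nonneg.2 (hab.trans ht))]

/-- The shift by one places the ramp on `[a - 1/k, a]`, so the value at `a` itself is one for every
`k`. Hence `smoothIco` vanishes exactly from `b` on, and the limit is determined at every point,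
spheres of positive mass included. -/
theorem tendsto_smoothTransition_indicator (a t : ℝ) :
    Filter.Tendsto (fun k : ℕ => Real.smoothTransition (k * (t - a) + 1)) Filter.atTop
      (nhds ((Set.Ici a).indicator (fun _ => 1) t)) := by
  by_cases h : a ≤ t
  · rw [Set.indicator_of_mem (Set.mem_Ici.2 h)]
    refine tendsto_const_nhds.congr fun k => (Real.smoothTransition.one_of_one_le ?_).symm
    linarith [mul_nonneg (Nat.cast_nonneg (α := ℝ) k) (sub_nonneg.2 h)]
  · rw [Set.indicator_of_notMem (mt Set.mem_Ici.1 h)]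
    have h' : 0 < a - t := sub_pos.2 (not_le.1 h)
    obtain ⟨K, hK⟩ := exists_nat_ge (1 / (a - t))
    refine tendsto_const_nhds.congr' ?_
    filter_upwards [Filter.eventually_ge_atTop K] with k hk
    refine (Real.smoothTransition.zero_of_nonpos ?_).symm
    rw [div_le_iff₀ h'] at hK
    have : (K : ℝ) * (a - t) ≤ k * (a - t) :=
      mul_le_mul_of_nonneg_right (by exact_mod_cast hk) h'.le
    linarith

theorem tendsto_smoothIco (hab : a ≤ b) (t : ℝ) :
    Filter.Tendsto (fun k => smoothIco a b k t) Filter.atTop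
      (nhds ((Set.Ico a b).indicator (fun _ => 1) t)) := by
  have h := (tendsto_smoothTransition_indicator a t).sub (tendsto_smoothTransition_indicator b t)
  have e : (Set.Ico a b).indicator (fun _ => (1 : ℝ)) t =
      (Set.Ici a).indicator (fun _ => 1) t - (Set.Ici b).indicator (fun _ => 1) t := by
    simp only [Set.indicator_apply, Set.mem_Ico, Set.mem_Ici]
    split_ifs <;> first | linarith | grind
  rw [e]
  exact h

/-- The primitive, vanishing on `[b, ∞)`, of minus the approximate cutoff of `powProfile`. -/
noncomputable def cutoffPrimitive (p a b : ℝ) (k : ℕ) (s : ℝ) : ℝ :=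
  ∫ t in s..b, powProfile p a t * smoothIco a b k t

theorem continuous_powProfile_mul_smoothIco (ha : 0 < a) (k : ℕ) :
    Continuous fun t => powProfile p a t * smoothIco a b k t :=
  (continuous_powProfile ha).mul (continuous_smoothIco k)

theorem abs_powProfile_mul_smoothIco_le (hp : 0 ≤ p) (ha : 0 < a) (hab : a ≤ b) (k : ℕ) (t : ℝ) :
    |powProfile p a t * smoothIco a b k t| ≤ a ^ (-p - 1) / 2 := by
  rw [abs_of_nonneg (mul_nonneg (powProfile_nonneg ha t) (smoothIco_nonneg hab k t))]
  calc _ ≤ powProfile p a t * 1 :=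
        mul_le_mul_of_nonneg_left (smoothIco_le_one k t) (powProfile_nonneg ha t)
    _ ≤ _ := by rw [mul_one]; exact powProfile_le hp ha t

theorem hasDerivAt_cutoffPrimitive (ha : 0 < a) (k : ℕ) (s : ℝ) :
    HasDerivAt (cutoffPrimitive p a b k) (-(powProfile p a s * smoothIco a b k s)) s := by
  have hc := continuous_powProfile_mul_smoothIco (p := p) (b := b) ha k
  exact intervalIntegral.integral_hasDerivAt_left (hc.intervalIntegrable _ _)
    hc.aestronglyMeasurable.stronglyMeasurableAtFilter hc.continuousAt

theorem cutoffPrimitive_eq_zero (hab : a ≤ b) (k : ℕ) {s : ℝ} (hs : b ≤ s) :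
    cutoffPrimitive p a b k s = 0 := by
  rw [cutoffPrimitive, intervalIntegral.integral_symm, neg_eq_zero]
  refine (intervalIntegral.integral_congr (g := fun _ => 0) fun t ht => ?_).trans (by simp)
  rw [Set.uIcc_of_le hs] at ht
  simp only
  rw [smoothIco_eq_zero hab k ht.1, mul_zero]

theorem abs_cutoffPrimitive_le (hp : 0 ≤ p) (ha : 0 < a) (hab : a ≤ b) (k : ℕ) {s : ℝ}
    (hs0 : 0 ≤ s) (hs : s ≤ b) : |cutoffPrimitive p a b k s| ≤ a ^ (-p - 1) / 2 * b := by
  have h := intervalIntegral.norm_integral_le_of_norm_le_const (a := s) (b := b)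
    (f := fun t => powProfile p a t * smoothIco a b k t)
    fun t _ => abs_powProfile_mul_smoothIco_le hp ha hab k t
  refine h.trans (mul_le_mul_of_nonneg_left ?_ (by positivity))
  rw [abs_of_nonneg (by linarith)]
  linarith

theorem tendsto_cutoffPrimitive (hp : 0 ≤ p) (ha : 0 < a) (hab : a ≤ b) {s : ℝ} (hs : s ≤ b) :
    Filter.Tendsto (fun k => cutoffPrimitive p a b k s) Filter.atTop
      (nhds (∫ t in (max s a)..b, powProfile p a t)) := by
  have e : ∫ t in (max s a)..b, powProfile p a t =
      ∫ t in s..b, (Set.Ioc (max s a) b).indicator (powProfile p a) t := by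
    rw [intervalIntegral.integral_of_le (max_le hs hab), intervalIntegral.integral_of_le hs,
      setIntegral_indicator measurableSet_Ioc,
      Set.inter_eq_right.2 (Set.Ioc_subset_Ioc_left (le_max_left s a))]
  rw [e]
  refine intervalIntegral.tendsto_integral_filter_of_dominated_convergence
    (fun _ => a ^ (-p - 1) / 2) ?_ ?_ intervalIntegrable_const ?_
  · exact Filter.Eventually.of_forall fun k =>
      (continuous_powProfile_mul_smoothIco ha k).aestronglyMeasurable
  · exact Filter.Eventually.of_forall fun k => Filter.Eventually.of_forall fun t _ =>
      abs_powProfile_mul_smoothIco_le hp ha hab k t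
  -- The limit is the indicator of a half-open interval closed on the left, the target of one closed
  -- on the right; discarding the two endpoints reconciles them.
  · have hne : ∀ c : ℝ, ∀ᵐ t : ℝ, t ≠ c := fun c => Measure.ae_ne volume c
    filter_upwards [hne a, hne b] with t hta htb hts
    rw [Set.uIoc_of_le hs] at hts
    have h := (tendsto_smoothIco hab t).const_mul (powProfile p a t)
    convert h using 2
    by_cases h1 : a < t
    · rw [Set.indicator_of_mem (show t ∈ Set.Ioc (max s a) b from ⟨max_lt hts.1 h1, hts.2⟩),
        Set.indicator_of_mem (show t ∈ Set.Ico a b from ⟨h1.le, lt_of_le_of_ne hts.2 htb⟩), mul_one]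
    · rw [Set.indicator_of_notMem (fun h' => h1 ((le_max_right s a).trans_lt h'.1)),
        Set.indicator_of_notMem (fun h' => h1 (lt_of_le_of_ne h'.1 hta.symm)), mul_zero]

end Profile

/-! ### The monotonicity inequality -/

namespace RectifiableVarifold

variable {n N : ℕ} {R : ℝ} {V : RectifiableVarifold n N (ball (0 : EuclideanSpace ℝ (Fin N)) R)}

/-- The first variation formula for the radial field with truncated power profile. -/
theorem IsFStationary.truncated_power_identity (hV : V.IsFStationary) {r₁ r₂ p : ℝ} (hp : 0 ≤ p)
    (h0 : 0 < r₁) (h12 : r₁ < r₂) (h2 : r₂ < R) :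
    IntegrableOn (fun x => n * (∫ t in (max (‖x‖ ^ 2) (r₁ ^ 2))..(r₂ ^ 2), powProfile p (r₁ ^ 2) t)
        - 2 * (powProfile p (r₁ ^ 2) (‖x‖ ^ 2) *
          (Set.Ico (r₁ ^ 2) (r₂ ^ 2)).indicator (fun _ => 1) (‖x‖ ^ 2)) * (‖x‖ ^ 2 - V.normalSq x)
        - (∫ t in (max (‖x‖ ^ 2) (r₁ ^ 2))..(r₂ ^ 2), powProfile p (r₁ ^ 2) t) * V.normalSq x / 2)
      (ball 0 r₂) V.weight ∧
    ∫ x in ball 0 r₂, (n * (∫ t in (max (‖x‖ ^ 2) (r₁ ^ 2))..(r₂ ^ 2), powProfile p (r₁ ^ 2) t)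
        - 2 * (powProfile p (r₁ ^ 2) (‖x‖ ^ 2) *
          (Set.Ico (r₁ ^ 2) (r₂ ^ 2)).indicator (fun _ => 1) (‖x‖ ^ 2)) * (‖x‖ ^ 2 - V.normalSq x)
        - (∫ t in (max (‖x‖ ^ 2) (r₁ ^ 2))..(r₂ ^ 2), powProfile p (r₁ ^ 2) t) * V.normalSq x / 2)
      ∂V.weight = 0 := by
  have hfin := V.isFiniteMeasure_restrict_ball h2
  have ha : 0 < r₁ ^ 2 := by positivity
  have hab : r₁ ^ 2 ≤ r₂ ^ 2 := pow_le_pow_left₀ h0.le h12.le 2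
  generalize hA : r₁ ^ 2 = a at ha hab
  generalize hB : r₂ ^ 2 = b at hab
  let F : ℕ → EuclideanSpace ℝ (Fin N) → ℝ := fun k x =>
    n * cutoffPrimitive p a b k (‖x‖ ^ 2)
      - 2 * (powProfile p a (‖x‖ ^ 2) * smoothIco a b k (‖x‖ ^ 2)) * (‖x‖ ^ 2 - V.normalSq x)
      - cutoffPrimitive p a b k (‖x‖ ^ 2) * V.normalSq x / 2
  have hFe : ∀ k x, F k x = n * cutoffPrimitive p a b k (‖x‖ ^ 2)
      + 2 * (-(powProfile p a (‖x‖ ^ 2) * smoothIco a b k (‖x‖ ^ 2))) * (‖x‖ ^ 2 - V.normalSq x)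
      - cutoffPrimitive p a b k (‖x‖ ^ 2) * V.normalSq x / 2 := fun k x => by
    simp only [F]
    ring
  have hid := fun k => hV.radial_identity (h0.le.trans h12.le) h2
    (hasDerivAt_cutoffPrimitive (p := p) (b := b) ha k)
    (continuous_powProfile_mul_smoothIco ha k).neg
    (fun s hs => cutoffPrimitive_eq_zero hab k (hB.symm.trans_le hs))
  simp only [← hFe] at hid
  set W : ℝ := a ^ (-p - 1) / 2 with hW
  have hW0 : 0 ≤ W := by positivity
  have hb0 : 0 ≤ b := ha.le.trans hab
  -- Any bound uniform in `k` will do, since the ball has finite weight; this one uses `|x|² ≤ b`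
  -- and `q ≤ b`.
  have hbd : ∀ k, ∀ᵐ x ∂V.weight.restrict (ball 0 r₂),
      ‖F k x‖ ≤ n * (W * b) + 2 * W * b + W * b * b / 2 := by
    intro k
    filter_upwards [ae_restrict_mem measurableSet_ball] with x hx
    have hq := V.normalSq_le_of_mem_ball hx
    have hq0 := V.normalSq_nonneg x
    have hqs := V.normalSq_le x
    have hs0 : 0 ≤ ‖x‖ ^ 2 := sq_nonneg _
    have hs : ‖x‖ ^ 2 ≤ b :=
      (pow_le_pow_left₀ (norm_nonneg _) (mem_ball_zero_iff.1 hx).le 2).trans_eq hB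
    rw [hB] at hq
    have c1 := abs_cutoffPrimitive_le (k := k) hp ha hab hs0 hs
    have c2 := abs_powProfile_mul_smoothIco_le (k := k) hp ha hab (‖x‖ ^ 2)
    rw [← hW] at c1 c2
    have d1 : |n * cutoffPrimitive p a b k (‖x‖ ^ 2)| ≤ n * (W * b) := by
      rw [abs_mul, Nat.abs_cast]
      exact mul_le_mul_of_nonneg_left c1 (Nat.cast_nonneg n)
    have d2 : |2 * (powProfile p a (‖x‖ ^ 2) * smoothIco a b k (‖x‖ ^ 2)) *
        (‖x‖ ^ 2 - V.normalSq x)| ≤ 2 * W * b := by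
      rw [abs_mul, abs_mul 2, abs_two, abs_of_nonneg (sub_nonneg.2 hqs)]
      exact mul_le_mul (mul_le_mul_of_nonneg_left c2 zero_le_two) (by linarith)
        (sub_nonneg.2 hqs) (by positivity)
    have d3 : |cutoffPrimitive p a b k (‖x‖ ^ 2) * V.normalSq x / 2| ≤ W * b * b / 2 := by
      rw [abs_div, abs_two, abs_mul, abs_of_nonneg hq0]
      exact div_le_div_of_nonneg_right (mul_le_mul c1 hq hq0 (by positivity)) zero_le_two
    exact (abs_sub _ _).trans (add_le_add ((abs_sub _ _).trans (add_le_add d1 d2)) d3)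
  have hpt : ∀ᵐ x ∂V.weight.restrict (ball 0 r₂), Filter.Tendsto (fun k => F k x) Filter.atTop
      (nhds (n * (∫ t in (max (‖x‖ ^ 2) a)..b, powProfile p a t)
        - 2 * (powProfile p a (‖x‖ ^ 2) *
          (Set.Ico a b).indicator (fun _ => 1) (‖x‖ ^ 2)) * (‖x‖ ^ 2 - V.normalSq x)
        - (∫ t in (max (‖x‖ ^ 2) a)..b, powProfile p a t) * V.normalSq x / 2)) := by
    filter_upwards [ae_restrict_mem measurableSet_ball] with x hx
    have hs : ‖x‖ ^ 2 ≤ b :=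
      (pow_le_pow_left₀ (norm_nonneg _) (mem_ball_zero_iff.1 hx).le 2).trans_eq hB
    have t1 := tendsto_cutoffPrimitive hp ha hab hs
    have t2 := (tendsto_smoothIco hab (‖x‖ ^ 2)).const_mul (powProfile p a (‖x‖ ^ 2))
    exact ((t1.const_mul _).sub ((t2.const_mul 2).mul_const _)).sub ((t1.mul_const _).div_const 2)
  have hmeas := fun k => (hid k).1.aestronglyMeasurable
  have hlim := tendsto_integral_of_dominated_convergence _ hmeas (integrable_const _) hbd hpt
  simp only [fun k => (hid k).2] at hlim
  refine ⟨?_, tendsto_nhds_unique hlim tendsto_const_nhds⟩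
  refine Integrable.of_bound (aestronglyMeasurable_of_tendsto_ae Filter.atTop hmeas hpt)
    (n * (W * b) + 2 * W * b + W * b * b / 2) ?_
  filter_upwards [hpt, ae_all_iff.2 hbd] with x hx hx'
  exact le_of_tendsto' hx.norm hx'

theorem IsFStationary.monotonicity (hV : V.IsFStationary) {r₁ r₂ : ℝ}
    (h0 : Real.sqrt (4 + 2 * (n : ℝ)) ≤ r₁) (h12 : r₁ < r₂) (h2 : r₂ < R) :
    (1 - 2 * (n : ℝ) / r₂ ^ 2) * (V.weight.real (ball 0 r₂) / r₂ ^ n)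
        ≤ V.weight.real (ball 0 r₁) / r₁ ^ n := by
  have hfin := V.isFiniteMeasure_restrict_ball h2
  have hn : (0 : ℝ) ≤ n := Nat.cast_nonneg n
  have hr1 : 0 < r₁ := (Real.sqrt_pos.2 (by linarith)).trans_le h0
  have hr2 : 0 < r₂ := hr1.trans h12
  have hp : 0 ≤ (n : ℝ) / 2 := by positivity
  obtain ⟨hi, he⟩ := hV.truncated_power_identity hp hr1 h12 h2
  have hq := hV.integral_normalSq_le hr2 h2
  -- With `p = n / 2`, `4 (p + 1)` is `4 + 2 n`: this is where the lower bound on `r₁` enters.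
  have hpa : 4 * ((n : ℝ) / 2 + 1) ≤ r₁ ^ 2 := by
    have := Real.sqrt_le_iff.1 h0
    linarith [this.2]
  have ha : 0 < r₁ ^ 2 := by positivity
  have hb : 0 < r₂ ^ 2 := by positivity
  have hab : r₁ ^ 2 ≤ r₂ ^ 2 := pow_le_pow_left₀ hr1.le h12.le 2
  have hpow : ∀ {r : ℝ}, 0 < r → (r ^ 2) ^ (-((n : ℝ) / 2)) = (r ^ n)⁻¹ := by
    intro r hr
    rw [← Real.rpow_natCast r 2, ← Real.rpow_mul hr.le, ← Real.rpow_natCast r n,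
      ← Real.rpow_neg hr.le]
    congr 1
    push_cast
    ring
  have hpow' : (r₂ ^ 2) ^ (-((n : ℝ) / 2) - 1) = (r₂ ^ n)⁻¹ / r₂ ^ 2 := by
    rw [Real.rpow_sub_one hb.ne', hpow hr2]
  have hind : IntegrableOn ((ball (0 : EuclideanSpace ℝ (Fin N)) r₁).indicator
      fun _ => (r₁ ^ n)⁻¹) (ball 0 r₂) V.weight :=
    (integrable_const _).indicator measurableSet_ball
  have hqi := (V.integrableOn_normalSq h2).mul_const ((r₂ ^ n)⁻¹ / r₂ ^ 2)
  -- The integrand here dominates pointwise the one in the truncated identity, whose integral is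
  -- zero.
  have hmono : (0 : ℝ) ≤ ∫ x in ball 0 r₂,
      ((ball (0 : EuclideanSpace ℝ (Fin N)) r₁).indicator (fun _ => (r₁ ^ n)⁻¹) x - (r₂ ^ n)⁻¹
        + V.normalSq x * ((r₂ ^ n)⁻¹ / r₂ ^ 2)) ∂V.weight := by
    rw [← he]
    refine setIntegral_mono_on hi ((hind.sub (integrable_const _)).add hqi) measurableSet_ball
      fun x hx => ?_
    have hs : ‖x‖ ^ 2 < r₂ ^ 2 :=
      pow_lt_pow_left₀ (mem_ball_zero_iff.1 hx) (norm_nonneg _) two_ne_zero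
    have hq0 := V.normalSq_nonneg x
    -- In the annulus `n ψ = s⁻ᵖ - b⁻ᵖ`, and its `s⁻ᵖ` cancels against the `ψ'` term; only `-b⁻ᵖ`
    -- and the multiple of `q` controlled by `e2` survive.
    by_cases hx1 : r₁ ^ 2 ≤ ‖x‖ ^ 2
    · have hnot : x ∉ ball (0 : EuclideanSpace ℝ (Fin N)) r₁ := fun h =>
        not_lt.2 hx1 (pow_lt_pow_left₀ (mem_ball_zero_iff.1 h) (norm_nonneg _) two_ne_zero)
      have e1 := integral_powProfile (p := (n : ℝ) / 2) ha hx1 hs.le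
      have e2 := rpow_sub_le_integral_powProfile ha hpa hx1 hs.le
      have hs0 : 0 < ‖x‖ ^ 2 := ha.trans_le hx1
      have e3 : (‖x‖ ^ 2) ^ (-((n : ℝ) / 2) - 1) * ‖x‖ ^ 2 = (‖x‖ ^ 2) ^ (-((n : ℝ) / 2)) := by
        rw [← Real.rpow_add_one hs0.ne']
        ring_nf
      rw [hpow hr2] at e1
      rw [hpow'] at e2
      rw [max_eq_left hx1, Set.indicator_of_notMem hnot, powProfile_of_le hx1,
        Set.indicator_of_mem (show ‖x‖ ^ 2 ∈ Set.Ico (r₁ ^ 2) (r₂ ^ 2) from ⟨hx1, hs⟩)]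
      have e4 := mul_le_mul_of_nonneg_right e2 hq0
      linarith
    -- On the inner ball `ψ` is constant, so the `ψ'` term is absent and `-ψ q / 2 ≤ 0` is dropped;
    -- the `q` term of the majorant is pure surplus there.
    · have hx1' := not_le.1 hx1
      have hmem : x ∈ ball (0 : EuclideanSpace ℝ (Fin N)) r₁ :=
        mem_ball_zero_iff.2 (lt_of_pow_lt_pow_left₀ 2 hr1.le hx1')
      have e1 := integral_powProfile (p := (n : ℝ) / 2) ha le_rfl hab
      have e2 : 0 ≤ ∫ t in (r₁ ^ 2)..(r₂ ^ 2), powProfile ((n : ℝ) / 2) (r₁ ^ 2) t :=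
        intervalIntegral.integral_nonneg hab fun t _ => powProfile_nonneg ha t
      rw [hpow hr2, hpow hr1] at e1
      rw [max_eq_right hx1'.le, Set.indicator_of_mem hmem,
        Set.indicator_of_notMem fun h => hx1 h.1]
      have e4 := mul_nonneg e2 hq0
      have e5 : 0 ≤ V.normalSq x * ((r₂ ^ n)⁻¹ / r₂ ^ 2) := by positivity
      linarith
  have hconst : IntegrableOn (fun _ => (r₂ ^ n)⁻¹) (ball (0 : EuclideanSpace ℝ (Fin N)) r₂)
      V.weight := integrable_const _
  have hsub : IntegrableOn (fun x => (ball (0 : EuclideanSpace ℝ (Fin N)) r₁).indicator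
      (fun _ => (r₁ ^ n)⁻¹) x - (r₂ ^ n)⁻¹) (ball 0 r₂) V.weight := hind.sub hconst
  rw [integral_add hsub hqi, integral_sub hind hconst,
    integral_mul_const, setIntegral_const, setIntegral_indicator measurableSet_ball,
    Set.inter_eq_right.2 (ball_subset_ball h12.le), setIntegral_const, smul_eq_mul,
    smul_eq_mul] at hmono
  have hfac : 0 ≤ (r₂ ^ n)⁻¹ / r₂ ^ 2 := by positivity
  -- The bound `∫ q ≤ 2 n Vol` on the ball of radius `r₂` absorbs the remaining error term.
  have := mul_le_mul_of_nonneg_right hq hfac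
  have e : (1 - 2 * (n : ℝ) / r₂ ^ 2) * (V.weight.real (ball 0 r₂) / r₂ ^ n) =
      V.weight.real (ball 0 r₂) * (r₂ ^ n)⁻¹
        - 2 * n * V.weight.real (ball 0 r₂) * ((r₂ ^ n)⁻¹ / r₂ ^ 2) := by
    field_simp
  rw [e, div_eq_mul_inv (V.weight.real (ball 0 r₁)) (r₁ ^ n)]
  linarith

end RectifiableVarifold

theorem mainTheorem8 (n N : ℕ) (R : ℝ)
    (V : RectifiableVarifold n N (ball (0 : EuclideanSpace ℝ (Fin N)) R))
    (hV : V.IsFStationary) :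
    (∀ r₁ r₂ : ℝ, Real.sqrt (4 + 2 * (n : ℝ)) ≤ r₁ → r₁ < r₂ → r₂ < R →
      (1 - 2 * (n : ℝ) / r₂ ^ 2) * (V.weight.real (ball 0 r₂) / r₂ ^ n)
        ≤ V.weight.real (ball 0 r₁) / r₁ ^ n) ∧
    (∃ H : EuclideanSpace ℝ (Fin N) → EuclideanSpace ℝ (Fin N), V.IsMeanCurvature H) ∧
    (∀ H : EuclideanSpace ℝ (Fin N) → EuclideanSpace ℝ (Fin N), V.IsMeanCurvature H →
      ∀ r : ℝ, 0 < r → r < R →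
        IntegrableOn (fun x => ‖H x‖ ^ 2) (ball 0 r) V.weight ∧
        ∫ x in ball 0 r, ‖H x‖ ^ 2 ∂V.weight ≤ (n : ℝ) / 2 * V.weight.real (ball 0 r)) :=
  ⟨fun _ _ h0 h12 h2 => hV.monotonicity h0 h12 h2, ⟨_, hV.isMeanCurvature isOpen_ball⟩,
    fun _ hH _ hr0 hr => hV.integral_sq_norm_curvature hH hr0 hr⟩
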